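/- For a set $X$ and $n\in\mathbb{N}$ let $\sigma_n(2^X)=\{\chi_A\in\{0,1\}^X : A\subseteq X,\ |A|\le n\}$, a compact subspace of $\{0,1\}^X$ with the product topology, and let $C(K)$ denote the Banach space of continuous real-valued functions on a compact space $K$ with the supremum norm. For $m<n$, a bounded linear operator $T:C(\sigma_m(2^X))\to C(\sigma_n(2^X))$ is called an \emph{extension operator} if, for every $f\in C(\sigma_m(2^X))$, the function $Tf$ extends $f$. For $Y\subseteq X$ the \emph{restricted operator} $T|_Y:C(\sigma_m(2^Y))\to C(\sigma_n(2^Y))$ is $T|_Y=r_Y^X\circ T\circ e_Y^X$, where $e_Y^X:C(\sigma_m(2^Y))\to C(\sigma_m(2^X))$ is given by $e_Y^X(f)(\chi_A)=f(\chi_{A\cap Y})$ and $r_Y^X:C(\sigma_n(2^X))\to C(\sigma_n(2^Y))$ by $r_Y^X(f)(\chi_A)=f(\chi_A)$. The \emph{canonical operator} $T_Y:C(\sigma_m(2^Y))\to C(\sigma_n(2^Y))$ is given by $T_Y(f)(\chi_A)=f(\chi_A)$ if $|A|\le m$, and by $$T_Y(f)(\chi_A)=\sum_{B\subseteq A,\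 |B|\le m}(-1)^{m-|B|}\binom{|A|-|B|-1}{m-|B|}f(\chi_B)\qquad\text{if }|A|>m.$$ \textbf{Theorem.} Let $m<n\le p$ be natural numbers, let $\varepsilon>0$, and let $X$ be a set with $|X|\ge\aleph_{p-1}$. If $T:C(\sigma_m(2^X))\to C(\sigma_n(2^X))$ is any extension operator, then there is a set $Y\subseteq X$ with $|Y|=p$ such that $\|T|_Y-T_Y\|<\varepsilon$ in the operator norm. -/

import Mathlib

open scoped Cardinal

noncomputable section

namespace SigmaSpace

/-- The characteristic function `χ_A ∈ {0,1}^X` of a finite set `A ⊆ X`; here `{0,1}` is `Bool`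
with its discrete topology, and `{0,1}^X` carries the product topology. -/
def chi {X : Type*} (A : Finset X) : X → Bool := by
  classical exact fun x => decide (x ∈ A)

/-- `σ_n(2^X) = {χ_A ∈ {0,1}^X : |A| ≤ n}`, with the subspace topology of `{0,1}^X`. -/
def sigma (n : ℕ) (X : Type*) : Set (X → Bool) :=
  {x | ∃ A : Finset X, A.card ≤ n ∧ chi A = x}

theorem chi_eq_true {X : Type*} (A : Finset X) (i : X) : chi A i = true ↔ i ∈ A := by
  simp [chi]

theorem mem_sigma_iff {n : ℕ} {X : Type*} (x : X → Bool) :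
    x ∈ sigma n X ↔ {i | x i = true}.encard ≤ n := by
  constructor
  · rintro ⟨A, hA, rfl⟩
    have : {i | chi A i = true} = (A : Set X) := by
      ext i; simp [chi_eq_true]
    rw [this, Set.encard_coe_eq_coe_finsetCard]
    exact_mod_cast hA
  · intro h
    have hf : {i | x i = true}.Finite := Set.finite_of_encard_le_coe h
    refine ⟨hf.toFinset, ?_, ?_⟩
    · rw [hf.encard_eq_coe_toFinset_card] at h
      exact_mod_cast h
    · funext i
      rw [Bool.eq_iff_iff, chi_eq_true]
      simp

theorem isClosed_sigma (n : ℕ) (X : Type*) : IsClosed (sigma n X) := by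
  rw [← isOpen_compl_iff, isOpen_iff_forall_mem_open]
  intro x hx
  rw [Set.mem_compl_iff, mem_sigma_iff, not_le] at hx
  obtain ⟨t, ht, htc⟩ := Set.exists_subset_encard_eq (Order.add_one_le_of_lt hx)
  have htf : t.Finite := Set.finite_of_encard_le_coe (k := n + 1) (by rw [htc]; simp)
  refine ⟨{y | ∀ i ∈ t, y i = true}, ?_, ?_, fun i hi => ht hi⟩
  · intro y hy
    rw [Set.mem_compl_iff, mem_sigma_iff, not_le]
    have h1 : t.encard ≤ {i | y i = true}.encard := Set.encard_le_encard fun i hi => hy i hi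
    rw [htc] at h1
    refine lt_of_lt_of_le ?_ h1
    exact_mod_cast Nat.lt_succ_self n
  · have : {y : X → Bool | ∀ i ∈ t, y i = true} = ⋂ i ∈ t, {y | y i = true} := by
      ext y; simp
    rw [this]
    exact htf.isOpen_biInter fun i _ =>
      (isOpen_discrete {b : Bool | b = true}).preimage (f := fun y : X → Bool => y i)
        (continuous_apply i)

instance compactSpace_sigma (n : ℕ) (X : Type*) : CompactSpace (sigma n X) :=
  isCompact_iff_compactSpace.mp (isClosed_sigma n X).isCompact

/-- The point `χ_A` of `σ_n(2^X)`, for a finite set `A` with `|A| ≤ n`. -/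
def point {n : ℕ} {X : Type*} (A : {A : Finset X // A.card ≤ n}) : sigma n X :=
  ⟨chi A.1, A.1, A.2, rfl⟩

theorem finite_support {n : ℕ} {X : Type*} (a : sigma n X) : {i | a.1 i = true}.Finite :=
  Set.finite_of_encard_le_coe ((mem_sigma_iff a.1).1 a.2)

/-- The set `A` of which a given point of `σ_n(2^X)` is the characteristic function. -/
def supp {n : ℕ} {X : Type*} (a : sigma n X) : Finset X := (finite_support a).toFinset

theorem supp_point {n : ℕ} {X : Type*} (A : {A : Finset X // A.card ≤ n}) :
    supp (point A) = A.1 := by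
  ext i
  simp [supp, point, chi_eq_true]

/-- `T : C(L) → C(K)`, a bounded linear operator, is an extension operator if `T f` extends `f`
for every `f ∈ C(L)` (here `L` and `K` are subspaces of an ambient space `Z`, with `L ⊆ K`). -/
def IsExtensionOperator {Z : Type*} [TopologicalSpace Z] {L K : Set Z}
    (T : C(L, ℝ) →L[ℝ] C(K, ℝ)) : Prop :=
  ∀ (f : C(L, ℝ)) (x : Z) (hL : x ∈ L) (hK : x ∈ K), T f ⟨x, hK⟩ = f ⟨x, hL⟩

/-- The function `T_X(f)` on `σ_n(2^X)`: its value at `χ_A` is `f(χ_A)` if `|A| ≤ m`, and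
`∑_{B ⊆ A, |B| ≤ m} (-1)^{m-|B|} binom(|A|-|B|-1, m-|B|) f(χ_B)` if `|A| > m`. -/
def canonicalFun (m n : ℕ) {X : Type*} (f : C(sigma m X, ℝ)) (a : sigma n X) : ℝ :=
  if h : (supp a).card ≤ m then f (point ⟨supp a, h⟩)
  else ∑ B ∈ (supp a).powerset.subtype (fun B => B.card ≤ m),
    (-1 : ℝ) ^ (m - B.1.card) * (((supp a).card - B.1.card - 1).choose (m - B.1.card) : ℝ) *
      f (point B)

/-- The canonical operator `T_X : C(σ_m(2^X)) → C(σ_n(2^X))`, for a finite set `X` (so that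
`σ_m(2^X)` and `σ_n(2^X)` are finite and discrete). -/
def canonicalOperator (m n : ℕ) (X : Type*) [Finite X] :
    C(sigma m X, ℝ) →L[ℝ] C(sigma n X, ℝ) where
  toFun f := ⟨canonicalFun m n f, continuous_of_discreteTopology⟩
  map_add' f g := by
    ext a
    simp only [ContinuousMap.coe_mk, ContinuousMap.add_apply, canonicalFun]
    split_ifs
    · rfl
    · simp only [mul_add, Finset.sum_add_distrib]
  map_smul' c f := by
    ext a
    simp only [ContinuousMap.coe_mk, ContinuousMap.smul_apply, canonicalFun, smul_eq_mul,
      RingHom.id_apply]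
    split_ifs
    · rfl
    · rw [Finset.mul_sum]
      exact Finset.sum_congr rfl fun B _ => by ring
  cont := by
    refine ContinuousMap.continuous_of_continuous_uncurry _ ?_
    refine continuous_prod_of_discrete_right.2 fun a => ?_
    simp only [Function.uncurry, ContinuousMap.coe_mk, canonicalFun]
    split_ifs
    · exact continuous_eval_const _
    · exact continuous_finsetSum _ fun B _ =>
        continuous_const.mul (continuous_eval_const _)

/-- Composition `f ↦ f ∘ g`, as a bounded linear operator `C(K) → C(L)`, for `g : L → K`. -/
def compOperator {L K : Type*} [TopologicalSpace L] [TopologicalSpace K] (g : C(L, K)) :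
    C(K, ℝ) →L[ℝ] C(L, ℝ) where
  toFun f := f.comp g
  map_add' _ _ := rfl
  map_smul' _ _ := rfl
  cont := ContinuousMap.continuous_precomp g

/-- The map `σ_m(2^X) → σ_m(2^Y)`, `χ_A ↦ χ_{A ∩ Y}`, for `Y ⊆ X`. -/
def traceMap (m : ℕ) {X : Type*} (Y : Set X) : C(sigma m X, sigma m Y) where
  toFun a := ⟨fun y => a.1 y, by
    rw [mem_sigma_iff]
    refine le_trans ?_ ((mem_sigma_iff a.1).1 a.2)
    rw [← Subtype.val_injective.encard_image]
    refine Set.encard_le_encard ?_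
    rintro _ ⟨y, hy, rfl⟩
    exact hy⟩
  continuous_toFun := Continuous.subtype_mk
    (continuous_pi fun y => (continuous_apply y.1).comp continuous_subtype_val) _

/-- The inclusion `σ_n(2^Y) → σ_n(2^X)`, `χ_A ↦ χ_A`, for `Y ⊆ X`. -/
def inclusionMap (n : ℕ) {X : Type*} (Y : Set X) : C(sigma n Y, sigma n X) where
  toFun a := ⟨chi ((supp a).map (Function.Embedding.subtype _)), _, by
    rw [Finset.card_map]
    have h := (mem_sigma_iff a.1).1 a.2
    rw [(finite_support a).encard_eq_coe_toFinset_card] at h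
    exact_mod_cast h, rfl⟩
  continuous_toFun := by
    refine Continuous.subtype_mk (continuous_pi fun i => ?_) _
    by_cases hi : i ∈ Y
    · have : (fun a : sigma n Y => chi ((supp a).map (Function.Embedding.subtype _)) i) =
          fun a => a.1 ⟨i, hi⟩ := by
        funext a
        rw [Bool.eq_iff_iff, chi_eq_true]
        simp [supp, hi]
      rw [this]
      exact (continuous_apply (⟨i, hi⟩ : Y)).comp continuous_subtype_val
    · have : (fun a : sigma n Y => chi ((supp a).map (Function.Embedding.subtype _)) i) =
          fun _ => false := by
        funext a
        rw [← Bool.not_eq_true, chi_eq_true]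
        simp [hi]
      rw [this]
      exact continuous_const

/-- `e_Y^X : C(σ_m(2^Y)) → C(σ_m(2^X))`, `e_Y^X(f)(χ_A) = f(χ_{A ∩ Y})`. -/
def embeddingOperator (m : ℕ) {X : Type*} (Y : Set X) :
    C(sigma m Y, ℝ) →L[ℝ] C(sigma m X, ℝ) := compOperator (traceMap m Y)

/-- `r_Y^X : C(σ_n(2^X)) → C(σ_n(2^Y))`, `r_Y^X(f)(χ_A) = f(χ_A)`. -/
def restrictionOperator (n : ℕ) {X : Type*} (Y : Set X) :
    C(sigma n X, ℝ) →L[ℝ] C(sigma n Y, ℝ) := compOperator (inclusionMap n Y)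

/-- The restricted operator `T|_Y = r_Y^X ∘ T ∘ e_Y^X : C(σ_m(2^Y)) → C(σ_n(2^Y))`. -/
def restrictedOperator {m n : ℕ} {X : Type*} (T : C(sigma m X, ℝ) →L[ℝ] C(sigma n X, ℝ))
    (Y : Set X) : C(sigma m Y, ℝ) →L[ℝ] C(sigma n Y, ℝ) :=
  (restrictionOperator n Y).comp (T.comp (embeddingOperator m Y))

end SigmaSpace

end

/-! For finite `Y`, the cylinder functions `cylinder m D` with `|D| ≤ m` span `C(σ_m(2^Y))`, the
coefficients of `f` being its Möbius transform, and the canonical operator is the one taking each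
cylinder function to the cylinder function of the same `D` on `σ_n(2^Y)`. So it suffices to find `Y`
for which `T (cylinder m D)` at `χ_A` is close to `1` if `D ⊆ A` and close to `0` otherwise, for all
`D, A ⊆ Y` of admissible size.

If `D ⊆ A`, continuity at `χ_D`, where the value is `1`, gives this once `A \ D` avoids a finite set
`G D`. If some `y ∈ D` is not in `A`, boundedness gives it once `y` avoids a finite set `H`
depending on `A` (`finite_setOf_lt_abs`). Kuratowski's theorem (`exists_free_finset`) supplies `p`
points avoiding all these sets at once. -/

/-! ### Free sets. -/

/-- Kuratowski's free set theorem for finite-valued set mappings. -/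
theorem exists_free_finset (k : ℕ) {X : Type*} [DecidableEq X] (hX : ℵ_ (k : Ordinal) ≤ #X)
    (F : Finset X → Finset X) :
    ∃ Y : Finset X, Y.card = k + 1 ∧ ∀ y ∈ Y, y ∉ F (Y.erase y) := by
  classical
  induction k generalizing X with
  | zero =>
    have : Infinite X := by
      rw [Cardinal.infinite_iff]
      simpa using hX
    obtain ⟨y, hy⟩ := Infinite.exists_notMem_finset (F ∅)
    exact ⟨{y}, by simp, by simpa using hy⟩
  | succ k ih =>
    have hlt : ℵ_ (k : Ordinal) < #X := by
      refine lt_of_lt_of_le ?_ hX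
      rw [Cardinal.aleph_lt_aleph]
      exact_mod_cast Nat.lt_succ_self k
    -- The values of `F` on finite subsets of `Z` cover at most `ℵ_k` points, so some `x` outside
    -- `Z` avoids them all. The other points come from induction inside `Z`, with `x` added to every
    -- argument of `F`.
    obtain ⟨Z, hZ⟩ := Cardinal.le_mk_iff_exists_set.1 hlt.le
    have hinf : Infinite Z := by
      rw [Cardinal.infinite_iff, hZ]
      exact Cardinal.aleph0_le_aleph _
    let emb : Z ↪ X := Function.Embedding.subtype _
    have hcard : #(⋃ S : Finset Z, (F (S.map emb) : Set X)) ≤ ℵ_ (k : Ordinal) := by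
      refine (Cardinal.mk_iUnion_le _).trans ?_
      rw [Cardinal.mk_finset_of_infinite, hZ]
      refine (Cardinal.mul_le_max_of_aleph0_le_left (Cardinal.aleph0_le_aleph _)).trans ?_
      refine max_le le_rfl (ciSup_le' fun S => ?_)
      exact (Cardinal.mk_le_aleph0 (α := (F (S.map emb) : Set X))).trans
        (Cardinal.aleph0_le_aleph _)
    obtain ⟨x, hx⟩ : ∃ x, x ∉ (⋃ S : Finset Z, (F (S.map emb) : Set X)) ∪ Z := by
      by_contra! h
      have huniv := Set.eq_univ_of_forall h
      have h1 : #X ≤ ℵ_ (k : Ordinal) := by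
        rw [← Cardinal.mk_univ, ← huniv]
        refine (Cardinal.mk_union_le _ _).trans ?_
        refine (add_le_add hcard hZ.le).trans ?_
        rw [Cardinal.add_eq_self (Cardinal.aleph0_le_aleph _)]
      exact absurd hlt h1.not_gt
    simp only [Set.mem_union, Set.mem_iUnion, not_or, not_exists] at hx
    obtain ⟨hxF, hxZ⟩ := hx
    obtain ⟨Y, hYc, hY⟩ := ih (X := Z) hZ.ge
      (fun S => (F (insert x (S.map emb))).subtype (· ∈ Z))
    have hxY : x ∉ Y.map emb := by
      intro h
      obtain ⟨z, -, rfl⟩ := Finset.mem_map.1 h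
      exact hxZ z.2
    refine ⟨insert x (Y.map emb), by rw [Finset.card_insert_of_notMem hxY, Finset.card_map, hYc],
      fun y hy => ?_⟩
    rcases Finset.mem_insert.1 hy with rfl | hy
    · rw [Finset.erase_insert hxY]
      exact hxF Y
    · obtain ⟨z, hz, rfl⟩ := Finset.mem_map.1 hy
      have hne : x ≠ emb z := fun h => hxY (h ▸ hy)
      rw [Finset.erase_insert_of_ne hne, ← Finset.map_erase]
      intro h
      exact hY z hz (Finset.mem_subtype.2 h)

/-! ### Möbius inversion truncated at size `m`. -/

/-- Write `D = B ∪ E` with `E ⊆ A \ B` and group by `|E|`. This is the coefficient of `g B` in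
`sum_moebiusTransform`. -/
theorem alternating_sum_interval {Z : Type*} [DecidableEq Z] {A B : Finset Z} (m : ℕ)
    (hBA : B ⊆ A) (hB : B.card ≤ m) :
    ∑ D ∈ A.powerset with D.card ≤ m ∧ B ⊆ D, (-1 : ℝ) ^ (D.card - B.card) =
      ∑ j ∈ Finset.range (m - B.card + 1), (-1 : ℝ) ^ j * ((A.card - B.card).choose j : ℝ) := by
  have h1 : ∑ D ∈ A.powerset with D.card ≤ m ∧ B ⊆ D, (-1 : ℝ) ^ (D.card - B.card) =
      ∑ E ∈ (A \ B).powerset with E.card < m - B.card + 1, (-1 : ℝ) ^ E.card := by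
    refine Finset.sum_bij' (fun D _ => D \ B) (fun E _ => E ∪ B) ?_ ?_ ?_ ?_ ?_
    · intro D hD
      simp only [Finset.mem_filter, Finset.mem_powerset] at hD ⊢
      refine ⟨Finset.sdiff_subset_sdiff hD.1 le_rfl, ?_⟩
      rw [Finset.card_sdiff_of_subset hD.2.2]
      omega
    · intro E hE
      simp only [Finset.mem_filter, Finset.mem_powerset] at hE ⊢
      refine ⟨Finset.union_subset (hE.1.trans Finset.sdiff_subset) hBA, ?_,
        Finset.subset_union_right⟩
      have := Finset.card_union_le E B
      omega
    · intro D hD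
      simp only [Finset.mem_filter] at hD
      exact Finset.sdiff_union_of_subset hD.2.2
    · intro E hE
      simp only [Finset.mem_filter, Finset.mem_powerset] at hE
      exact Finset.union_sdiff_cancel_right
        (Finset.disjoint_of_subset_left hE.1 Finset.sdiff_disjoint)
    · intro D hD
      simp only [Finset.mem_filter] at hD
      rw [Finset.card_sdiff_of_subset hD.2.2]
  rw [h1, ← Finset.sum_fiberwise_of_maps_to (g := Finset.card)
    (t := Finset.range (m - B.card + 1))
    (fun E hE => Finset.mem_range.2 (Finset.mem_filter.1 hE).2)]
  refine Finset.sum_congr rfl fun j hj => ?_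
  have h2 : ((A \ B).powerset.filter (fun E => E.card < m - B.card + 1)).filter
      (fun E => E.card = j) = (A \ B).powersetCard j := by
    ext E
    simp only [Finset.mem_filter, Finset.mem_powerset, Finset.mem_powersetCard]
    rw [Finset.mem_range] at hj
    constructor
    · rintro ⟨⟨h, -⟩, h'⟩; exact ⟨h, h'⟩
    · rintro ⟨h, h'⟩; exact ⟨⟨h, h' ▸ hj⟩, h'⟩
  rw [h2, Finset.sum_congr rfl fun E hE => by rw [(Finset.mem_powersetCard.1 hE).2],
    Finset.sum_const, Finset.card_powersetCard, Finset.card_sdiff_of_subset hBA, nsmul_eq_mul,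
    mul_comm]

/-- The Möbius transform of a function on finite sets. -/
noncomputable def moebiusTransform {Z : Type*} (g : Finset Z → ℝ) (D : Finset Z) : ℝ :=
  ∑ B ∈ D.powerset, (-1 : ℝ) ^ (D.card - B.card) * g B

theorem abs_moebiusTransform_le {Z : Type*} {g : Finset Z → ℝ} {M : ℝ}
    (hg : ∀ B, |g B| ≤ M) (D : Finset Z) : |moebiusTransform g D| ≤ 2 ^ D.card * M := by
  refine (Finset.abs_sum_le_sum_abs _ _).trans ?_
  refine (Finset.sum_le_card_nsmul _ _ M fun B _ => ?_).trans ?_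
  · rw [abs_mul, abs_pow, abs_neg, abs_one, one_pow, one_mul]
    exact hg B
  · rw [Finset.card_powerset, nsmul_eq_mul]
    push_cast
    exact le_rfl

theorem sum_moebiusTransform {Z : Type*} [DecidableEq Z] (m : ℕ) (g : Finset Z → ℝ)
    (A : Finset Z) :
    ∑ D ∈ A.powerset with D.card ≤ m, moebiusTransform g D =
      ∑ B ∈ A.powerset with B.card ≤ m,
        (∑ j ∈ Finset.range (m - B.card + 1),
          (-1 : ℝ) ^ j * ((A.card - B.card).choose j : ℝ)) * g B := by
  unfold moebiusTransform
  rw [Finset.sum_comm' (t' := A.powerset.filter fun B => B.card ≤ m)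
    (s' := fun B => A.powerset.filter fun D => D.card ≤ m ∧ B ⊆ D)]
  · refine Finset.sum_congr rfl fun B hB => ?_
    simp only [Finset.mem_filter, Finset.mem_powerset] at hB
    rw [← Finset.sum_mul, alternating_sum_interval m hB.1 hB.2]
  · intro D B
    simp only [Finset.mem_filter, Finset.mem_powerset]
    constructor
    · rintro ⟨⟨h1, h2⟩, h3⟩
      exact ⟨⟨h1, h2, h3⟩, h3.trans h1, (Finset.card_le_card h3).trans h2⟩
    · rintro ⟨⟨h1, h2, h3⟩, -⟩
      exact ⟨⟨h1, h2⟩, h3⟩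

theorem sum_moebiusTransform_of_card_le {Z : Type*} [DecidableEq Z] {m : ℕ} (g : Finset Z → ℝ)
    {A : Finset Z} (hA : A.card ≤ m) :
    ∑ D ∈ A.powerset with D.card ≤ m, moebiusTransform g D = g A := by
  rw [sum_moebiusTransform, Finset.sum_eq_single A]
  · rw [Finset.sum_eq_single 0] <;> simp +contextual [Nat.choose_eq_zero_of_lt, Nat.pos_iff_ne_zero]
  · intro B hB hne
    simp only [Finset.mem_filter, Finset.mem_powerset] at hB
    have hlt : B.card < A.card := Finset.card_lt_card (hB.1.ssubset_of_ne hne)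
    have h0 : ∑ j ∈ Finset.range (A.card - B.card + 1),
        (-1 : ℝ) ^ j * ((A.card - B.card).choose j : ℝ) = 0 := by
      have := Int.alternating_sum_range_choose_of_ne (n := A.card - B.card) (by omega)
      exact_mod_cast congrArg (Int.cast : ℤ → ℝ) this
    -- The terms with `j > |A| - |B|` vanish, leaving the full alternating sum `(1 - 1)^(|A| - |B|)
    -- = 0`.
    rw [← Finset.sum_subset (s₁ := Finset.range (A.card - B.card + 1)), h0, zero_mul]
    · intro j hj
      rw [Finset.mem_range] at *
      omega
    · intro j _ hj
      rw [Finset.mem_range] at hj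
      rw [Nat.choose_eq_zero_of_lt (by omega)]
      simp
  · intro h
    exact absurd (by simp [hA]) h

/-- The coefficients are now genuinely partial alternating sums: `∑_{j ≤ k} (-1)^j binom(r+1, j) =
(-1)^k binom(r, k)`. This is where the binomials of the canonical operator come from. -/
theorem sum_moebiusTransform_of_lt_card {Z : Type*} [DecidableEq Z] {m : ℕ} (g : Finset Z → ℝ)
    {A : Finset Z} (hA : m < A.card) :
    ∑ D ∈ A.powerset with D.card ≤ m, moebiusTransform g D =
      ∑ B ∈ A.powerset with B.card ≤ m,
        (-1 : ℝ) ^ (m - B.card) * ((A.card - B.card - 1).choose (m - B.card) : ℝ) * g B := by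
  rw [sum_moebiusTransform]
  refine Finset.sum_congr rfl fun B hB => ?_
  simp only [Finset.mem_filter, Finset.mem_powerset] at hB
  congr 1
  obtain ⟨r, hr⟩ : ∃ r, A.card - B.card = r + 1 := ⟨A.card - B.card - 1, by omega⟩
  rw [hr, Nat.add_sub_cancel]
  have := Int.alternating_sum_range_choose_eq_choose (n := r) (m := m - B.card)
  exact_mod_cast congrArg (Int.cast : ℤ → ℝ) this
-- Cylinder functions and the canonical operator.
namespace SigmaSpace

theorem mem_supp {n : ℕ} {X : Type*} (a : sigma n X) (i : X) : i ∈ supp a ↔ a.1 i = true := by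
  simp [supp]

theorem card_supp_le {n : ℕ} {X : Type*} (a : sigma n X) : (supp a).card ≤ n := by
  have h := (mem_sigma_iff a.1).1 a.2
  rw [(finite_support a).encard_eq_coe_toFinset_card] at h
  exact_mod_cast h

theorem point_supp {n : ℕ} {X : Type*} (a : sigma n X) :
    point ⟨supp a, card_supp_le a⟩ = a := by
  apply Subtype.ext
  funext i
  change chi (supp a) i = a.1 i
  rw [Bool.eq_iff_iff, chi_eq_true, mem_supp]

/-- The indicator function of the clopen set `{χ_C : D ⊆ C}`. -/
noncomputable def cylinder (m : ℕ) {X : Type*} (D : Finset X) : C(sigma m X, ℝ) where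
  toFun a := ∏ i ∈ D, if a.1 i = true then 1 else 0
  continuous_toFun := continuous_finsetProd _ fun i _ =>
    (continuous_of_discreteTopology (f := fun b : Bool => if b = true then (1 : ℝ) else 0)).comp
      ((continuous_apply i).comp continuous_subtype_val)

theorem cylinder_apply {m : ℕ} {X : Type*} [DecidableEq X] (D : Finset X) (a : sigma m X) :
    cylinder m D a = if D ⊆ supp a then 1 else 0 := by
  change (∏ i ∈ D, if a.1 i = true then (1 : ℝ) else 0) = _
  rw [Finset.prod_ite_zero]
  simp only [Finset.prod_const_one, Finset.subset_iff, mem_supp]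

/-- The function on finite sets given by a function on `σ_m(2^X)`, extended by zero. -/
noncomputable def evalFinset {m : ℕ} {X : Type*} (f : C(sigma m X, ℝ)) (B : Finset X) : ℝ :=
  if h : B.card ≤ m then f (point ⟨B, h⟩) else 0

theorem evalFinset_supp {m : ℕ} {X : Type*} (f : C(sigma m X, ℝ)) (a : sigma m X) :
    evalFinset f (supp a) = f a := by
  rw [evalFinset, dif_pos (card_supp_le a), point_supp]

theorem abs_evalFinset_le {m : ℕ} {X : Type*} (f : C(sigma m X, ℝ)) (B : Finset X) :
    |evalFinset f B| ≤ ‖f‖ := by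
  unfold evalFinset
  split_ifs
  · exact f.norm_coe_le_norm _
  · simp

theorem canonicalFun_eq_sum_moebiusTransform {m n : ℕ} {Z : Type*} [DecidableEq Z]
    (f : C(sigma m Z, ℝ)) (a : sigma n Z) :
    canonicalFun m n f a =
      ∑ D ∈ (supp a).powerset with D.card ≤ m, moebiusTransform (evalFinset f) D := by
  unfold canonicalFun
  split_ifs with h
  · rw [sum_moebiusTransform_of_card_le _ h, evalFinset, dif_pos h]
  · rw [sum_moebiusTransform_of_lt_card _ (not_le.1 h), ← Finset.sum_subtype_eq_sum_filter]
    refine Finset.sum_congr rfl fun B _ => ?_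
    rw [evalFinset, dif_pos B.2]

theorem eq_sum_moebiusTransform_smul_cylinder {m : ℕ} {Z : Type*} [Fintype Z] [DecidableEq Z]
    (f : C(sigma m Z, ℝ)) :
    f = ∑ D : Finset Z with D.card ≤ m, moebiusTransform (evalFinset f) D • cylinder m D := by
  ext a
  rw [ContinuousMap.sum_apply]
  simp only [ContinuousMap.smul_apply, cylinder_apply, smul_eq_mul, mul_ite, mul_one, mul_zero]
  rw [← Finset.sum_filter, Finset.filter_filter, ← evalFinset_supp f a,
    ← sum_moebiusTransform_of_card_le (evalFinset f) (card_supp_le a)]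
  refine Finset.sum_congr ?_ fun _ _ => rfl
  ext D
  simp [and_comm]

/-! ### Almost canonical behaviour of `T` on cylinder functions. -/

/-- A functional on `C(σ_m(2^X))` is large only on functions supported in `{χ_C : y ∈ C}` for
finitely many `y`. -/
theorem finite_setOf_lt_abs {m : ℕ} {X : Type*} (φ : C(sigma m X, ℝ) →L[ℝ] ℝ) {δ : ℝ}
    (hδ : 0 < δ) :
    {y : X | ∃ f : C(sigma m X, ℝ), (∀ a, |f a| ≤ 1) ∧ (∀ a, a.1 y = false → f a = 0) ∧
      δ < |φ f|}.Finite := by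
  classical
  by_contra hinf
  obtain ⟨N, hN⟩ := exists_nat_gt (‖φ‖ * m / δ)
  obtain ⟨t, hts, htc⟩ := Set.Infinite.exists_subset_card_eq hinf N
  have hts' : ∀ y ∈ t, ∃ f : C(sigma m X, ℝ), (∀ a, |f a| ≤ 1) ∧
      (∀ a, a.1 y = false → f a = 0) ∧ δ < |φ f| := fun y hy => hts hy
  choose! f hf1 hf0 hfδ using hts'
  -- At each point at most `m` of the `f y` are nonzero, so `‖g‖ ≤ m`, while the signs force `φ g ≥
  -- N * δ > ‖φ‖ * m`.
  let g : C(sigma m X, ℝ) := ∑ y ∈ t, (SignType.sign (φ (f y)) : ℝ) • f y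
  have hg : ‖g‖ ≤ m := by
    rw [ContinuousMap.norm_le _ (Nat.cast_nonneg m)]
    intro a
    have h1 : g a = ∑ y ∈ t, (SignType.sign (φ (f y)) : ℝ) * f y a := by
      simp [g, ContinuousMap.sum_apply]
    rw [h1, ← Finset.sum_filter_of_ne (p := fun y => y ∈ supp a), Real.norm_eq_abs]
    · refine (Finset.abs_sum_le_sum_abs _ _).trans ((Finset.sum_le_card_nsmul _ _ 1 ?_).trans ?_)
      · intro y hy
        rw [abs_mul]
        have hs : |(SignType.sign (φ (f y)) : ℝ)| ≤ 1 := by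
          rcases SignType.sign (φ (f y)) with _ | _ | _ <;> simp
        exact mul_le_one₀ hs (abs_nonneg _) (hf1 y (Finset.mem_filter.1 hy).1 a)
      · rw [nsmul_eq_mul, mul_one, Nat.cast_le]
        refine le_trans (Finset.card_le_card fun y hy => ?_) (card_supp_le a)
        exact (Finset.mem_filter.1 hy).2
    · intro y hy hne
      rw [mem_supp]
      by_contra h
      exact hne (by rw [hf0 y hy a (by simpa using h), mul_zero])
  have hφg : φ g = ∑ y ∈ t, |φ (f y)| := by
    simp only [g, map_sum, map_smul, smul_eq_mul, sign_mul_self]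
  have h1 : (N : ℝ) * δ ≤ φ g := by
    rw [hφg, ← htc, ← nsmul_eq_mul]
    exact Finset.card_nsmul_le_sum _ _ _ fun y hy => (hfδ y hy).le
  have h2 : φ g ≤ ‖φ‖ * m :=
    (le_abs_self _).trans ((φ.le_opNorm g).trans (by gcongr))
  rw [div_lt_iff₀ hδ] at hN
  linarith

theorem exists_finset_abs_sub_lt {n : ℕ} {X : Type*} (h : C(sigma n X, ℝ)) (a : sigma n X)
    {δ : ℝ} (hδ : 0 < δ) :
    ∃ G : Finset X, ∀ b : sigma n X, (∀ i ∈ G, b.1 i = a.1 i) → |h b - h a| < δ := by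
  have ho : IsOpen (h ⁻¹' Metric.ball (h a) δ) := Metric.isOpen_ball.preimage h.continuous
  obtain ⟨U, hU, hUeq⟩ := isOpen_induced_iff.1 ho
  have haU : a.1 ∈ U := by
    have : a ∈ h ⁻¹' Metric.ball (h a) δ := by simpa using hδ
    rwa [← hUeq] at this
  obtain ⟨G, u, hu, hsub⟩ := isOpen_pi_iff.1 hU a.1 haU
  refine ⟨G, fun b hb => ?_⟩
  have hbU : b ∈ Subtype.val ⁻¹' U := hsub fun i hi => by
    rw [hb i hi]
    exact (hu i hi).2
  rw [hUeq] at hbU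
  simpa [Real.dist_eq] using hbU

/-- On the subsets of a suitable set `Y` of size `p`, the operator acts on cylinder functions
almost like the canonical one. -/
theorem exists_finset_extension_cylinder {X : Type*} [DecidableEq X] (m n p : ℕ) (hmn : m < n)
    (hnp : n ≤ p) {δ : ℝ} (hδ : 0 < δ) (hX : ℵ_ ((p - 1 : ℕ) : Ordinal) ≤ #X)
    (T : C(sigma m X, ℝ) →L[ℝ] C(sigma n X, ℝ)) (hT : IsExtensionOperator T) :
    ∃ Y : Finset X, Y.card = p ∧ ∀ D ⊆ Y, D.card ≤ m → ∀ a : sigma n X, supp a ⊆ Y →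
      |T (cylinder m D) a - if D ⊆ supp a then 1 else 0| ≤ δ := by
  classical
  have hsmall : ∀ a : sigma n X, ∃ H : Finset X, ∀ D : Finset X, ∀ y ∈ D, y ∉ supp a → y ∉ H →
      |T (cylinder m D) a| ≤ δ := by
    intro a
    have hfin := finite_setOf_lt_abs ((ContinuousMap.evalCLM ℝ a).comp T) hδ
    refine ⟨hfin.toFinset, fun D y hyD _ hyH => ?_⟩
    by_contra! hlt
    refine hyH (hfin.mem_toFinset.2 ⟨cylinder m D, fun b => ?_, fun b hb => ?_, hlt⟩)
    · rw [cylinder_apply]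
      split_ifs <;> simp
    · rw [cylinder_apply, if_neg]
      intro hD
      have := (mem_supp b y).1 (hD hyD)
      simp [hb] at this
  have hnear : ∀ D : Finset X, ∃ G : Finset X, D.card ≤ m → ∀ b : sigma n X, D ⊆ supp b →
      (∀ y ∈ supp b, y ∉ D → y ∉ G) → |T (cylinder m D) b - 1| ≤ δ := by
    intro D
    by_cases hD : D.card ≤ m
    · obtain ⟨G, hG⟩ := exists_finset_abs_sub_lt (T (cylinder m D))
        (point ⟨D, hD.trans hmn.le⟩) hδ
      refine ⟨G, fun _ b hDb hb => ?_⟩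
      have h1 : T (cylinder m D) (point ⟨D, hD.trans hmn.le⟩) = 1 := by
        have := hT (cylinder m D) (chi D) (point (n := m) ⟨D, hD⟩).2
          (point (n := n) ⟨D, hD.trans hmn.le⟩).2
        refine this.trans ?_
        change cylinder m D (point ⟨D, hD⟩) = 1
        rw [cylinder_apply, supp_point, if_pos (Finset.Subset.refl D)]
      rw [← h1]
      refine (hG b fun i hi => ?_).le
      change b.1 i = chi D i
      rw [Bool.eq_iff_iff, chi_eq_true, ← mem_supp]
      exact ⟨fun hib => by_contra fun hiD => hb i hib hiD hi, fun h => hDb h⟩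
    · exact ⟨∅, fun h => absurd h hD⟩
  choose H hH using hsmall
  choose G hG using hnear
  let H' : Finset X → Finset X := fun A => if h : A.card ≤ n then H (point ⟨A, h⟩) else ∅
  -- Taking the union over all subsets makes freeness at `Y.erase y` apply to every `A ⊆ Y` that
  -- misses `y`.
  obtain ⟨Y, hYc, hY⟩ := exists_free_finset (p - 1) hX
    (fun S => S.powerset.biUnion fun A => H' A ∪ G A)
  have hfree : ∀ A ⊆ Y, ∀ y ∈ Y, y ∉ A → y ∉ H' A ∪ G A := by
    intro A hA y hy hyA h
    exact hY y hy (Finset.mem_biUnion.2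
      ⟨A, Finset.mem_powerset.2 (Finset.subset_erase.2 ⟨hA, hyA⟩), h⟩)
  refine ⟨Y, by omega, fun D hDY hD a haY => ?_⟩
  split_ifs with hDa
  · refine hG D hD a hDa fun y hy hyD h => ?_
    exact hfree D hDY y (haY hy) hyD (Finset.mem_union_right _ h)
  · obtain ⟨y, hyD, hya⟩ := Finset.not_subset.1 hDa
    rw [sub_zero]
    refine hH a D y hyD hya fun h => ?_
    refine hfree _ haY y (hDY hyD) hya (Finset.mem_union_left _ ?_)
    simp only [H']
    rwa [dif_pos (card_supp_le a), point_supp]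

/-- For `D ⊆ Y`, the conditions `D ⊆ A ∩ Y` and `D ⊆ A` agree. -/
theorem embeddingOperator_cylinder (m : ℕ) {X : Type*} (Y : Set X) (D : Finset Y) :
    embeddingOperator m Y (cylinder m D) =
      cylinder m (D.map (Function.Embedding.subtype _)) := by
  ext a
  change (∏ i ∈ D, if a.1 i = true then (1 : ℝ) else 0) = ∏ i ∈ D.map _, _
  rw [Finset.prod_map]
  rfl

theorem supp_inclusionMap (n : ℕ) {X : Type*} (Y : Set X) (a : sigma n Y) :
    supp (inclusionMap n Y a) = (supp a).map (Function.Embedding.subtype _) := by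
  ext i
  rw [mem_supp]
  exact chi_eq_true _ _

end SigmaSpace

/-! ### The norm estimate. -/

open SigmaSpace in
theorem mainTheorem4 {X : Type*} (m n p : ℕ) (hmn : m < n) (hnp : n ≤ p)
    (ε : ℝ) (hε : 0 < ε) (hX : ℵ_ ((p - 1 : ℕ) : Ordinal) ≤ #X)
    (T : C(SigmaSpace.sigma m X, ℝ) →L[ℝ] C(SigmaSpace.sigma n X, ℝ))
    (hT : SigmaSpace.IsExtensionOperator T) :
    ∃ Y : Finset X, Y.card = p ∧
      ‖SigmaSpace.restrictedOperator T (Y : Set X) -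
        SigmaSpace.canonicalOperator m n (Y : Set X)‖ < ε := by
  classical
  -- There are at most `2 ^ p` sets `D`, each with a coefficient of size at most `2 ^ p * ‖f‖`;
  -- halving `ε` makes the final inequality strict.
  have hδ : 0 < ε / 2 / (2 ^ p * 2 ^ p) := by positivity
  obtain ⟨Y, hYc, hY⟩ := exists_finset_extension_cylinder m n p hmn hnp hδ hX T hT
  refine ⟨Y, hYc, lt_of_le_of_lt ?_ (half_lt_self hε)⟩
  refine ContinuousLinearMap.opNorm_le_bound _ (half_pos hε).le fun f => ?_
  rw [ContinuousMap.norm_le _ (by positivity)]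
  intro a
  let emb : (Y : Set X) ↪ X := Function.Embedding.subtype _
  let b := inclusionMap n (Y : Set X) a
  let μ := moebiusTransform (evalFinset f)
  have hcard : Fintype.card (Y : Set X) = p := by simpa using hYc
  have h1 : restrictedOperator T (Y : Set X) f a =
      ∑ D : Finset (Y : Set X) with D.card ≤ m, μ D * T (cylinder m (D.map emb)) b := by
    change T (embeddingOperator m (Y : Set X) f) b = _
    conv_lhs => rw [eq_sum_moebiusTransform_smul_cylinder f]
    simp only [map_sum, map_smul, embeddingOperator_cylinder, ContinuousMap.sum_apply,
      ContinuousMap.smul_apply, smul_eq_mul]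
    rfl
  have h2 : canonicalOperator m n (Y : Set X) f a =
      ∑ D : Finset (Y : Set X) with D.card ≤ m, μ D * if D.map emb ⊆ supp b then 1 else 0 := by
    change canonicalFun m n f a = _
    rw [canonicalFun_eq_sum_moebiusTransform]
    simp only [mul_ite, mul_one, mul_zero]
    rw [← Finset.sum_filter, Finset.filter_filter]
    refine Finset.sum_congr ?_ fun _ _ => rfl
    ext D
    simp only [b, supp_inclusionMap, Finset.mem_filter, Finset.mem_powerset, Finset.mem_univ,
      true_and]
    rw [Finset.map_subset_map, and_comm]
  have hterm : ∀ D ∈ (Finset.univ : Finset (Finset (Y : Set X))).filter (fun D => D.card ≤ m),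
      |μ D * T (cylinder m (D.map emb)) b - μ D * if D.map emb ⊆ supp b then 1 else 0| ≤
        2 ^ p * ‖f‖ * (ε / 2 / (2 ^ p * 2 ^ p)) := by
    intro D hD
    have hsub : ∀ E : Finset (Y : Set X), E.map emb ⊆ Y := by
      intro E x hx
      obtain ⟨z, -, rfl⟩ := Finset.mem_map.1 hx
      exact z.2
    rw [← mul_sub, abs_mul]
    refine mul_le_mul ?_ (hY _ (hsub D) ?_ b ?_) (abs_nonneg _) (by positivity)
    · refine (abs_moebiusTransform_le (abs_evalFinset_le f) D).trans ?_
      have : D.card ≤ p := hcard ▸ Finset.card_le_univ D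
      gcongr
      norm_num
    · rw [Finset.card_map]
      exact (Finset.mem_filter.1 hD).2
    · simp only [b, supp_inclusionMap]
      exact hsub _
  rw [sub_apply, ContinuousMap.sub_apply, h1, h2, ← Finset.sum_sub_distrib,
    Real.norm_eq_abs]
  refine (Finset.abs_sum_le_sum_abs _ _).trans ((Finset.sum_le_card_nsmul _ _ _ hterm).trans ?_)
  rw [nsmul_eq_mul]
  have hc : (((Finset.univ : Finset (Finset (Y : Set X))).filter (fun D => D.card ≤ m)).card : ℝ)
      ≤ 2 ^ p := by
    have := Finset.card_filter_le (Finset.univ : Finset (Finset (Y : Set X))) (fun D => D.card ≤ m)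
    rw [Finset.card_univ, Fintype.card_finset, hcard] at this
    exact_mod_cast this
  calc _ ≤ 2 ^ p * (2 ^ p * ‖f‖ * (ε / 2 / (2 ^ p * 2 ^ p))) := by gcongr
    _ = ε / 2 * ‖f‖ := by field_simp
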